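/- Let $\alpha>0$ be real. The initial value problem $F'(x)=1-F(x)^\alpha$ for $x\ge 0$, $F(0)=0$, has a unique solution $F_\alpha$ on $[0,\infty)$. Put $$\phi_\alpha(t):=1-F_\alpha\left(-\tfrac1\alpha\ln t\right),\qquad t\in(0,1].$$ Define $$\gamma_\alpha:=\frac1\alpha\exp\left(-\int_0^1\frac{1-x^{(1-\alpha)/\alpha}}{1-x}\,dx\right),$$ where the integral converges absolutely, and define real numbers $\sigma_k$, $k\ge1$ (depending on $\alpha$), by $$\sigma_1:=1,\qquad \sigma_k:=\frac{1}{k(k-1)}\sum_{\nu=1}^{k-1}\sigma_\nu\,\sigma_{k-\nu}\,\bigl[(1+\alpha)\nu-\alpha k\bigr]\,\nu\qquad(k\ge2).$$ Then the following hold. (i) There is $\varepsilon>0$, depending on $\alpha$, such that the restriction of $\phi_\alpha$ to $(0,1)$ extends to a real analytic function on $(-\varepsilon,1)$. Such an extension is unique for each $\varepsilon$, and is again denoted by $\phi_\alpha$. (ii) The Taylor series of $\phi_\alpha$ at $0$ is $\sum_{k\ge1}\sigma_k\gamma_\alpha^k t^k$; that is, for all $t$ in some neighbourhood of $0$, $$\phi_\alpha(t)=\sum_{k=1}^\infty\sigma_k(\gamma_\alpha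 t)^k .$$ (iii) If $0<\alpha<1$, then $\sigma_k>0$ for all $k\ge1$, the series in (ii) converges for every $t\in(-1,1)$, and its sum is $\phi_\alpha(t)$ at every $t\in(-1,1)$ to which $\phi_\alpha$ has been continued as in (i). (iv) If $0<\alpha<1$, then $\phi_\alpha$ extends to a real analytic function on $(-\infty,1)$, and this extension is strictly increasing and convex on $(-\infty,1)$. -/

import Mathlib

open Set

/-- `F` solves the initial value problem `F' = 1 - F ^ α`, `F 0 = 0` on `[0, ∞)`
(one-sided derivative at `0`). Values of `F` at negative arguments play no role. -/
def IsProfile (α : ℝ) (F : ℝ → ℝ) : Prop :=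
  F 0 = 0 ∧ ∀ x, 0 ≤ x → HasDerivWithinAt F (1 - F x ^ α) (Ici 0) x

/-- `φ(t) = 1 - F(-(1/α) ln t)`; meaningful for `t ∈ (0, 1]` only. -/
noncomputable def profilePhi (α : ℝ) (F : ℝ → ℝ) (t : ℝ) : ℝ :=
  1 - F (-(1 / α) * Real.log t)

/-- `g` is a real analytic continuation to the open set `U` of the function `f` on `(0, 1)`.
No condition is put on the values of `f` outside `(0, 1)` or on those of `g` outside `U`. -/
def IsAnalyticContinuation (f : ℝ → ℝ) (U : Set ℝ) (g : ℝ → ℝ) : Prop :=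
  Ioo 0 1 ⊆ U ∧ AnalyticOnNhd ℝ g U ∧ EqOn g f (Ioo 0 1)

/-- The integrand `(1 - x ^ ((1 - α) / α)) / (1 - x)`. -/
noncomputable def gammaIntegrand (α : ℝ) (x : ℝ) : ℝ :=
  (1 - x ^ ((1 - α) / α)) / (1 - x)

/-- The constant `γ_α`. -/
noncomputable def profileGamma (α : ℝ) : ℝ :=
  1 / α * Real.exp (-∫ x in (0 : ℝ)..1, gammaIntegrand α x)

/-- The coefficients `σ_k`, `k ≥ 1` (the value at `k = 0` is a convention). The recurrence is
written with `k = n + 2` and summation index `ν - 1`; see `profileSigma_rec` for the usual form. -/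
noncomputable def profileSigma (α : ℝ) : ℕ → ℝ
  | 0 => 0
  | 1 => 1
  | n + 2 => 1 / (((n : ℝ) + 2) * ((n : ℝ) + 1)) *
      ∑ ν : Fin (n + 1), profileSigma α (ν + 1) * profileSigma α (n + 1 - ν) *
        ((1 + α) * ((ν : ℝ) + 1) - α * ((n : ℝ) + 2)) * ((ν : ℝ) + 1)

theorem profileSigma_one (α : ℝ) : profileSigma α 1 = 1 := by
  simp [profileSigma]

theorem profileSigma_rec (α : ℝ) (k : ℕ) (hk : 2 ≤ k) :
    profileSigma α k = 1 / ((k : ℝ) * ((k : ℝ) - 1)) *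
      ∑ ν ∈ Finset.Icc 1 (k - 1), profileSigma α ν * profileSigma α (k - ν) *
        ((1 + α) * (ν : ℝ) - α * (k : ℝ)) * (ν : ℝ) := by
  obtain ⟨n, rfl⟩ := Nat.exists_eq_add_of_le' hk
  have hI : Finset.Icc 1 (n + 2 - 1) = Finset.Ico 1 (n + 2) := by
    ext x
    simp only [Finset.mem_Icc, Finset.mem_Ico]
    omega
  rw [hI, Finset.sum_Ico_eq_sum_range, profileSigma, ← Fin.sum_univ_eq_sum_range
    (fun i => profileSigma α (1 + i) * profileSigma α (n + 2 - (1 + i)) *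
        ((1 + α) * ((1 + i : ℕ) : ℝ) - α * ((n + 2 : ℕ) : ℝ)) * ((1 + i : ℕ) : ℝ))]
  congr 1
  · push_cast
    congr 2
    ring
  · refine Finset.sum_congr rfl fun ν _ => ?_
    have h1 : n + 2 - (1 + (ν : ℕ)) = n + 1 - ν := by omega
    rw [h1, add_comm 1 (ν : ℕ)]
    push_cast
    ring

/-! Separation of variables solves the problem explicitly. With `D = profileDensity α` and `T =
profileTime α`, one has T(u) = (1 - u^α) D(u) for u ≥ 0 and T' = -α D (`profileTime_eq`). Hence
T(F(x)) e^{αx} has derivative zero, so T(F(x)) = e^{-αx}, which gives existence and uniqueness at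
once. Under t = e^{-αx} it reads φ(t) = 1 - T⁻¹(t). Since T(1) = 0, T'(1) = -α D(1) ≠ 0 and T is
analytic on u > 0, the inverse is analytic across t = 0. This is (i), with φ'(0) = 1/(α D(1)) = γ.
For (ii), αtφ' = 1 - (1 - φ)^α. Differentiating and eliminating the power gives tφ'' = φ (tφ')' - α
t φ'^2 (`profileExt_ode`); comparing coefficients gives the recurrence for σ_k γ^k. For α < 1,
pairing ν with k - ν shows σ_k > 0. A Pringsheim-type argument then bounds the Taylor polynomials on
[0, 1) by φ itself, whence convergence on (-1, 1). Moreover D is increasing, so T maps onto ℝ, and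
φ' = 1/(α D(T⁻¹(t))) is positive and increasing: this is (iv). -/

open Filter Topology

/-! ### Analytic primitives and the identity theorem -/

/-- A real function whose derivative is analytic at a point is itself analytic there. -/
theorem analyticAt_of_hasDerivAt {f f' : ℝ → ℝ} {x : ℝ}
    (hf : ∀ᶠ y in 𝓝 x, HasDerivAt f (f' y) y) (hf' : AnalyticAt ℝ f' x) :
    AnalyticAt ℝ f x := by
  obtain ⟨p, hp⟩ := hf'
  have h1 := hasFPowerSeriesAt_iff.1 hp
  have hc : ∀ᶠ y in 𝓝 x, ContinuousAt f' y :=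
    (AnalyticAt.eventually_analyticAt ⟨p, hp⟩).mono fun y hy => hy.continuousAt
  have hx : Tendsto (fun z : ℝ => x + z) (𝓝 0) (𝓝 x) := by
    have : Continuous fun z : ℝ => x + z := by fun_prop
    simpa using this.tendsto 0
  obtain ⟨r, hr, hball⟩ := Metric.eventually_nhds_iff.1 (h1.and ((hx.eventually hf).and
    (hx.eventually hc)))
  have hball' : ∀ z : ℝ, |z| < r → HasSum (fun n => z ^ n * p.coeff n) (f' (x + z)) ∧
      HasDerivAt f (f' (x + z)) (x + z) ∧ ContinuousAt f' (x + z) := fun z hz => by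
    simpa using hball (y := z) (by simpa using hz)
  -- Coefficients of the termwise primitive of the series of `f'`, with constant term `f x`.
  let c : ℕ → ℝ := fun n => match n with
    | 0 => f x
    | n + 1 => p.coeff n / (n + 1)
  refine ⟨FormalMultilinearSeries.ofScalars ℝ c, hasFPowerSeriesAt_iff.2 ?_⟩
  refine Metric.eventually_nhds_iff.2 ⟨r, hr, fun h hh => ?_⟩
  have hh : |h| < r := by simpa using hh
  simp only [FormalMultilinearSeries.coeff_ofScalars, smul_eq_mul]
  have hle : ∀ t ∈ uIcc 0 h, |t| ≤ |h| := fun t ht => by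
    simpa using abs_sub_left_of_mem_uIcc ht
  -- Termwise integration: on the segment from 0 to `h` each term is dominated by its absolute value
  -- at `h`.
  have hint : HasSum (fun n => ∫ t in (0 : ℝ)..h, t ^ n * p.coeff n)
      (∫ t in (0 : ℝ)..h, f' (x + t)) := by
    refine intervalIntegral.hasSum_integral_of_dominated_convergence
      (fun n _ => ‖h ^ n * p.coeff n‖) (fun n => ?_) (fun n => ?_) ?_ ?_ ?_
    · exact Continuous.aestronglyMeasurable (by fun_prop)
    · refine Eventually.of_forall fun t ht => ?_
      rw [norm_mul, norm_mul, norm_pow, norm_pow]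
      gcongr
      exact hle t (uIoc_subset_uIcc ht)
    · exact Eventually.of_forall fun t _ => (hball' h hh).1.summable.norm
    · exact intervalIntegrable_const
    · exact Eventually.of_forall fun t ht =>
        (hball' t ((hle t (uIoc_subset_uIcc ht)).trans_lt hh)).1
  have hftc : ∫ t in (0 : ℝ)..h, f' (x + t) = f (x + h) - f x := by
    have := intervalIntegral.integral_eq_sub_of_hasDerivAt (a := 0) (b := h)
      (f := fun t => f (x + t)) (f' := fun t => f' (x + t)) (fun t ht => ?_) ?_
    · simpa using this
    · exact (hball' t ((hle t ht).trans_lt hh)).2.1.comp_const_add x t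
    · refine ContinuousOn.intervalIntegrable fun t ht => ContinuousAt.continuousWithinAt ?_
      exact ContinuousAt.comp' (f := fun t => x + t)
        (hball' t ((hle t ht).trans_lt hh)).2.2 (by fun_prop)
  rw [hftc] at hint
  rw [← hasSum_nat_add_iff' 1]
  simp only [Finset.sum_range_one, pow_zero, one_mul, c]
  have hterm : (fun n : ℕ => h ^ (n + 1) * (p.coeff n / (n + 1))) =
      fun n => ∫ t in (0 : ℝ)..h, t ^ n * p.coeff n := by
    ext n
    rw [intervalIntegral.integral_mul_const, integral_pow]
    simp
    ring
  rw [hterm]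
  exact hint

/-- Two analytic functions on a preconnected open set that agree on a nonempty open subset agree
everywhere. -/
theorem AnalyticOnNhd.eqOn_of_eqOn_open {f g : ℝ → ℝ} {U V : Set ℝ} (hf : AnalyticOnNhd ℝ f U)
    (hg : AnalyticOnNhd ℝ g U) (hU : IsPreconnected U) (hV : IsOpen V) (hVU : V ⊆ U)
    (hne : V.Nonempty) (h : EqOn f g V) : EqOn f g U := by
  obtain ⟨z, hz⟩ := hne
  exact hf.eqOn_of_preconnected_of_eventuallyEq hg hU (hVU hz)
    (h.eventuallyEq_of_mem (hV.mem_nhds hz))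

/-! ### Calculus of Taylor coefficients at 0 -/

/-- The `n`-th Taylor coefficient of `f` at `0`. -/
noncomputable def taylorCoeff (f : ℝ → ℝ) (n : ℕ) : ℝ :=
  iteratedDeriv n f 0 / n.factorial

theorem taylorCoeff_congr {f g : ℝ → ℝ} (h : f =ᶠ[𝓝 0] g) (n : ℕ) :
    taylorCoeff f n = taylorCoeff g n := by
  rw [taylorCoeff, taylorCoeff, h.iteratedDeriv_eq]

theorem taylorCoeff_deriv (f : ℝ → ℝ) (n : ℕ) :
    taylorCoeff (deriv f) n = (n + 1) * taylorCoeff f (n + 1) := by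
  rw [taylorCoeff, taylorCoeff, iteratedDeriv_succ', Nat.factorial_succ]
  have : (n.factorial : ℝ) ≠ 0 := by positivity
  push_cast
  field_simp

theorem taylorCoeff_sub {f g : ℝ → ℝ} (hf : AnalyticAt ℝ f 0) (hg : AnalyticAt ℝ g 0) (n : ℕ) :
    taylorCoeff (fun t => f t - g t) n = taylorCoeff f n - taylorCoeff g n := by
  simp only [taylorCoeff]
  rw [iteratedDeriv_fun_sub hf.contDiffAt hg.contDiffAt, sub_div]

theorem taylorCoeff_const_mul (f : ℝ → ℝ) (c : ℝ) (n : ℕ) :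
    taylorCoeff (fun t => c * f t) n = c * taylorCoeff f n := by
  simp only [taylorCoeff]
  rw [iteratedDeriv_const_mul_field, mul_div_assoc]

theorem taylorCoeff_mul {f g : ℝ → ℝ} (hf : AnalyticAt ℝ f 0) (hg : AnalyticAt ℝ g 0) (n : ℕ) :
    taylorCoeff (fun t => f t * g t) n =
      ∑ i ∈ Finset.range (n + 1), taylorCoeff f i * taylorCoeff g (n - i) := by
  simp only [taylorCoeff]
  rw [iteratedDeriv_fun_mul hf.contDiffAt hg.contDiffAt, Finset.sum_div]
  refine Finset.sum_congr rfl fun i hi => ?_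
  rw [Nat.cast_choose ℝ (Nat.lt_succ_iff.1 (Finset.mem_range.1 hi))]
  have h1 : (n.factorial : ℝ) ≠ 0 := by positivity
  have h2 : (i.factorial : ℝ) ≠ 0 := by positivity
  have h3 : ((n - i).factorial : ℝ) ≠ 0 := by positivity
  field_simp

theorem taylorCoeff_id_mul {f : ℝ → ℝ} (hf : AnalyticAt ℝ f 0) (n : ℕ) :
    taylorCoeff (fun t => t * f t) n = if n = 0 then 0 else taylorCoeff f (n - 1) := by
  have hid : ∀ i, taylorCoeff (fun t => t) i = if i = 1 then 1 else 0 := fun i => by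
    rcases i with _ | _ | i
    · simp [taylorCoeff]
    · simp [taylorCoeff]
    · have : deriv (fun t : ℝ => t) = fun _ => 1 := by ext; simp
      simp [taylorCoeff, iteratedDeriv_succ', this, iteratedDeriv_const]
  rw [taylorCoeff_mul (f := fun t => t) analyticAt_id hf]
  simp only [hid]
  rcases n with _ | n
  · simp
  · rw [Finset.sum_eq_single 1] <;> simp +contextual

theorem AnalyticAt.eventually_hasSum_taylorCoeff {f : ℝ → ℝ} (hf : AnalyticAt ℝ f 0) :
    ∃ r > 0, ∀ t, |t| < r → HasSum (fun n => taylorCoeff f n * t ^ n) (f t) := by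
  obtain ⟨r, hr, h⟩ := Metric.eventually_nhds_iff.1 (hasFPowerSeriesAt_iff.1 hf.hasFPowerSeriesAt)
  refine ⟨r, hr, fun t ht => ?_⟩
  have := h (y := t) (by simpa using ht)
  simp only [FormalMultilinearSeries.coeff_ofScalars, smul_eq_mul, zero_add] at this
  simpa only [taylorCoeff, mul_comm] using this

/-! ### Power series with nonnegative coefficients -/

/-- The radius does not shrink with `n`, so one neighbourhood serves all derivatives simultaneously.
-/
theorem HasFPowerSeriesOnBall.exists_iteratedDeriv {f : ℝ → ℝ}
    {p : FormalMultilinearSeries ℝ ℝ ℝ} {x : ℝ} {r : ENNReal}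
    (h : HasFPowerSeriesOnBall f p x r) (n : ℕ) :
    ∃ q : FormalMultilinearSeries ℝ ℝ ℝ, HasFPowerSeriesOnBall (iteratedDeriv n f) q x r := by
  induction n with
  | zero => exact ⟨p, by simpa using h⟩
  | succ n ih =>
    obtain ⟨q, hq⟩ := ih
    rw [iteratedDeriv_succ]
    exact ⟨_, (ContinuousLinearMap.apply ℝ ℝ (1 : ℝ)).comp_hasFPowerSeriesOnBall hq.fderiv⟩

/-- Nonnegativity of all derivatives propagates to the right of a point of analyticity. -/
theorem AnalyticAt.eventually_iteratedDeriv_nonneg {f : ℝ → ℝ} {x : ℝ} (hf : AnalyticAt ℝ f x)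
    (h : ∀ n, 0 ≤ iteratedDeriv n f x) :
    ∀ᶠ y in 𝓝[>] x, ∀ n, 0 ≤ iteratedDeriv n f y := by
  obtain ⟨p, r, hp⟩ := hf
  filter_upwards [self_mem_nhdsWithin, nhdsWithin_le_nhds (Metric.eball_mem_nhds x hp.r_pos)]
    with y hy hyr n
  obtain ⟨q, hq⟩ := hp.exists_iteratedDeriv n
  have hq' := hq.analyticAt.hasFPowerSeriesAt.eq_formalMultilinearSeries hq.hasFPowerSeriesAt
  have hs := hq.hasSum (y := y - x) (by simpa [edist_eq_enorm_sub] using hyr)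
  rw [add_sub_cancel] at hs
  -- The `m`-th coefficient at `x` of the `n`-th derivative is the derivative of order `m + n`
  -- divided by `m!`.
  refine hs.nonneg fun m => ?_
  rw [← hq', FormalMultilinearSeries.apply_eq_pow_smul_coeff,
    FormalMultilinearSeries.coeff_ofScalars]
  have h1 : iteratedDeriv m (iteratedDeriv n f) x = iteratedDeriv (m + n) f x := by
    simp only [iteratedDeriv_eq_iterate, Function.iterate_add, Function.comp]
  rw [h1]
  have := h (m + n)
  have hxy : 0 ≤ y - x := sub_nonneg.2 (mem_Ioi.1 hy).le
  positivity

/-- A function analytic on `[0, b)` with nonnegative derivatives at `0` has nonnegative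
derivatives on `[0, b)`. -/
theorem AnalyticOnNhd.iteratedDeriv_nonneg {f : ℝ → ℝ} {b : ℝ} (hf : AnalyticOnNhd ℝ f (Ico 0 b))
    (h : ∀ n, 0 ≤ iteratedDeriv n f 0) {t : ℝ} (ht : t ∈ Ico 0 b) (n : ℕ) :
    0 ≤ iteratedDeriv n f t := by
  have hsub : Icc 0 t ⊆ Ico 0 b := fun y hy => ⟨hy.1, hy.2.trans_lt ht.2⟩
  have hcont : ∀ n, ContinuousOn (iteratedDeriv n f) (Icc 0 t) := fun n y hy => by
    rw [iteratedDeriv_eq_iterate]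
    exact ((hf.iterated_deriv n) y (hsub hy)).continuousAt.continuousWithinAt
  -- Continuous induction: the set is closed in the interval, contains 0 and extends to the right of
  -- each of its points.
  have key : Icc 0 t ⊆ {y | ∀ n, 0 ≤ iteratedDeriv n f y} := by
    refine IsClosed.Icc_subset_of_forall_mem_nhdsWithin ?_ h fun y hy => ?_
    · have : {y | ∀ n, 0 ≤ iteratedDeriv n f y} ∩ Icc 0 t =
          ⋂ n, Icc 0 t ∩ iteratedDeriv n f ⁻¹' Ici 0 := by
        ext y
        simp only [mem_inter_iff, mem_ofPred_eq, mem_iInter, mem_preimage, mem_Ici]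
        exact ⟨fun hy n => ⟨hy.2, hy.1 n⟩, fun hy => ⟨fun n => (hy n).2, (hy 0).1⟩⟩
      rw [this]
      exact isClosed_iInter fun n => (hcont n).preimage_isClosed_of_isClosed isClosed_Icc isClosed_Ici
    · exact (hf y (hsub (Ico_subset_Icc_self hy.2))).eventually_iteratedDeriv_nonneg hy.1
  exact key (right_mem_Icc.2 ht.1) n

/-- If all derivatives of `f` are nonnegative on `[0, b)`, its Taylor polynomials at `0` are
bounded above by `f` on `[0, b)`. -/
theorem sum_taylorCoeff_le {b : ℝ} (n : ℕ) : ∀ {f : ℝ → ℝ}, AnalyticOnNhd ℝ f (Ico 0 b) →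
    (∀ n, ∀ t ∈ Ico 0 b, 0 ≤ iteratedDeriv n f t) → ∀ t ∈ Ico 0 b,
    ∑ i ∈ Finset.range n, taylorCoeff f i * t ^ i ≤ f t := by
  induction n with
  | zero => intro f _ h t ht; simpa using h 0 t ht
  | succ n ih =>
    intro f hf h t ht
    have ihd := ih hf.deriv (fun n t ht => by simpa [iteratedDeriv_succ'] using h (n + 1) t ht)
    set S : ℝ → ℝ := fun t => f t - ∑ i ∈ Finset.range (n + 1), taylorCoeff f i * t ^ i with hS
    -- The derivative of the Taylor remainder `S` of `f` is the remainder of `deriv f` one order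
    -- lower, nonnegative by induction; and `S 0 = 0`.
    have hd : ∀ y ∈ Ico 0 b, HasDerivAt S
        (deriv f y - ∑ i ∈ Finset.range n, taylorCoeff (deriv f) i * y ^ i) y := fun y hy => by
      have h1 : HasDerivAt (fun t : ℝ => ∑ i ∈ Finset.range (n + 1), taylorCoeff f i * t ^ i)
          (∑ i ∈ Finset.range (n + 1), taylorCoeff f i * (i * y ^ (i - 1))) y :=
        HasDerivAt.fun_sum fun i _ => (hasDerivAt_pow i y).const_mul _
      refine ((hf y hy).differentiableAt.hasDerivAt.sub h1).congr_deriv ?_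
      congr 1
      rw [Finset.sum_range_succ']
      simp only [CharP.cast_eq_zero, zero_mul, mul_zero, add_zero, Nat.cast_add, Nat.cast_one,
        add_tsub_cancel_right, taylorCoeff_deriv]
      exact Finset.sum_congr rfl fun i _ => by ring
    have hmono : MonotoneOn S (Ico 0 b) := by
      refine monotoneOn_of_deriv_nonneg (convex_Ico 0 b)
        (fun y hy => (hd y hy).continuousAt.continuousWithinAt)
        (fun y hy => (hd y (interior_subset hy)).differentiableAt.differentiableWithinAt)
        fun y hy => ?_
      rw [(hd y (interior_subset hy)).deriv]
      exact sub_nonneg.2 (ihd y (interior_subset hy))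
    have h0 : S 0 = 0 := by
      simp [hS, Finset.sum_range_succ', taylorCoeff]
    have := hmono ⟨le_rfl, ht.1.trans_lt ht.2⟩ ht ht.1
    rw [h0] at this
    exact sub_nonneg.1 this

/-- The Taylor series at `0` of a function analytic on `[0, 1)` converges on `(-1, 1)` if its
coefficients are nonnegative. -/
theorem summable_taylorCoeff_of_nonneg {f : ℝ → ℝ} (hf : AnalyticOnNhd ℝ f (Ico 0 1))
    (h : ∀ n, 0 ≤ taylorCoeff f n) {t : ℝ} (ht : t ∈ Ioo (-1) 1) :
    Summable fun n => taylorCoeff f n * t ^ n := by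
  have h0 : ∀ n, 0 ≤ iteratedDeriv n f 0 := fun n => by
    have := h n
    rw [taylorCoeff] at this
    have h2 : (0 : ℝ) < n.factorial := by positivity
    simpa [div_mul_cancel₀ _ h2.ne'] using mul_nonneg this h2.le
  have ht' : |t| ∈ Ico 0 1 := ⟨abs_nonneg t, abs_lt.2 ht⟩
  refine Summable.of_norm ?_
  simp only [norm_mul, norm_pow, Real.norm_eq_abs, abs_of_nonneg (h _)]
  exact summable_of_sum_range_le (fun n => mul_nonneg (h n) (by positivity))
    fun n => sum_taylorCoeff_le n hf (fun n t ht => hf.iteratedDeriv_nonneg h0 ht n) _ ht'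

/-- A power series converging on `(-1, 1)` has an analytic sum there. -/
theorem analyticOnNhd_tsum {a : ℕ → ℝ}
    (h : ∀ t ∈ Ioo (-1 : ℝ) 1, Summable fun n => a n * t ^ n) :
    AnalyticOnNhd ℝ (fun t => ∑' n, a n * t ^ n) (Ioo (-1) 1) := by
  set p := FormalMultilinearSeries.ofScalars ℝ a with hp
  have hsum : ∀ t, p.sum t = ∑' n, a n * t ^ n := fun t => by
    refine tsum_congr fun n => ?_
    simp [hp, FormalMultilinearSeries.coeff_ofScalars, mul_comm]
  have hr : 1 ≤ p.radius := by
    refine ENNReal.le_of_forall_nnreal_lt fun r hr => ?_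
    refine p.le_radius_of_summable ?_
    have hr1 : (r : ℝ) < 1 := by exact_mod_cast hr
    have := (h r ⟨by linarith [r.coe_nonneg], hr1⟩).norm
    refine this.congr fun n => ?_
    rw [hp, FormalMultilinearSeries.ofScalars_norm]
    simp
  have hball := (p.hasFPowerSeriesOnBall (one_pos.trans_le hr)).analyticOnNhd
  intro t ht
  have h1 : (fun t => ∑' n, a n * t ^ n) = p.sum := (funext hsum).symm
  rw [h1]
  refine hball t ?_
  rw [Metric.mem_eball, edist_zero_right]
  refine lt_of_lt_of_le ?_ hr
  have := abs_lt.2 ht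
  rw [← ofReal_norm, ← ENNReal.ofReal_one]
  exact (ENNReal.ofReal_lt_ofReal_iff one_pos).2 (by simpa using this)

/-! ### The integrand of γ and its primitive -/

/-- The continuous extension of `gammaIntegrand α` to `(0, ∞)`. -/
noncomputable def gammaSlope (α : ℝ) : ℝ → ℝ :=
  dslope (fun x : ℝ => x ^ ((1 - α) / α)) 1

theorem one_sub_mul_gammaSlope (α w : ℝ) : (1 - w) * gammaSlope α w = 1 - w ^ ((1 - α) / α) := by
  have := sub_smul_dslope (fun x : ℝ => x ^ ((1 - α) / α)) 1 w
  simp only [smul_eq_mul, Real.one_rpow] at this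
  rw [gammaSlope]
  linarith

theorem gammaIntegrand_eq_gammaSlope (α : ℝ) {x : ℝ} (hx : x ≠ 1) :
    gammaIntegrand α x = gammaSlope α x := by
  rw [gammaIntegrand, ← one_sub_mul_gammaSlope, mul_div_cancel_left₀ _ (sub_ne_zero.2 hx.symm)]

theorem gammaIntegrand_ae_eq (α : ℝ) (s : Set ℝ) :
    gammaIntegrand α =ᵐ[MeasureTheory.volume.restrict s] gammaSlope α := by
  refine MeasureTheory.ae_restrict_of_ae ?_
  filter_upwards [MeasureTheory.Measure.ae_ne MeasureTheory.volume (1 : ℝ)] with x hx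
  exact gammaIntegrand_eq_gammaSlope α hx

theorem analyticAt_rpow_const {x : ℝ} (hx : x ≠ 0) (p : ℝ) :
    AnalyticAt ℝ (fun y : ℝ => y ^ p) x :=
  (Real.contDiffAt_rpow_const_of_ne (n := (⊤ : WithTop ℕ∞)) hx).analyticAt

theorem analyticAt_gammaSlope (α : ℝ) {x : ℝ} (hx : 0 < x) : AnalyticAt ℝ (gammaSlope α) x := by
  by_cases h1 : x = 1
  · subst h1
    obtain ⟨p, hp⟩ := analyticAt_rpow_const one_ne_zero ((1 - α) / α)
    exact ⟨_, hp.has_fpower_series_dslope_fslope⟩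
  · have : AnalyticAt ℝ (gammaIntegrand α) x :=
      (analyticAt_const.sub (analyticAt_rpow_const hx.ne' _)).div
        (analyticAt_const.sub analyticAt_id) (sub_ne_zero.2 (Ne.symm h1))
    refine this.congr ?_
    filter_upwards [isOpen_ne.mem_nhds h1] with y hy
    exact gammaIntegrand_eq_gammaSlope α hy

/-- A difference quotient of x^β with β = (1 - α)/α, which is increasing because α < 1 makes β
positive. -/
theorem gammaSlope_nonneg {α : ℝ} (hα : 0 < α) (hα1 : α < 1) {w : ℝ} (hw : 0 < w) :
    0 ≤ gammaSlope α w := by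
  have hβ : 0 < (1 - α) / α := div_pos (sub_pos.2 hα1) hα
  have h := one_sub_mul_gammaSlope α w
  rcases lt_trichotomy w 1 with h1 | h1 | h1
  · have := Real.rpow_lt_one hw.le h1 hβ
    by_contra! hc
    nlinarith
  · subst h1
    rw [gammaSlope, dslope_same]
    have := (Real.hasDerivAt_rpow_const (x := 1) (p := (1 - α) / α) (Or.inl one_ne_zero)).deriv
    rw [this]
    simpa using hβ.le
  · have := Real.one_lt_rpow h1 hβ
    by_contra! hc
    nlinarith

theorem intervalIntegrable_gammaSlope (α : ℝ) {a b : ℝ} (ha : 0 < a) (hb : 0 < b) :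
    IntervalIntegrable (gammaSlope α) MeasureTheory.volume a b := by
  refine ContinuousOn.intervalIntegrable fun x hx => ?_
  exact (analyticAt_gammaSlope α (lt_of_lt_of_le (lt_min ha hb) hx.1)).continuousAt.continuousWithinAt

/-- At 0 the exponent (1 - α)/α exceeds -1, and the singularity at 1 is removable. -/
theorem intervalIntegrable_gammaIntegrand {α : ℝ} (hα : 0 < α) {w : ℝ} (hw : 0 ≤ w) :
    IntervalIntegrable (gammaIntegrand α) MeasureTheory.volume 0 w := by
  rcases hw.eq_or_lt with rfl | hw
  · exact IntervalIntegrable.refl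
  have h1 : IntervalIntegrable (gammaIntegrand α) MeasureTheory.volume 0 (1 / 2) := by
    have hβ : -1 < (1 - α) / α := by
      rw [lt_div_iff₀ hα]; linarith
    have := (intervalIntegrable_const (c := (1 : ℝ))).sub
      (intervalIntegral.intervalIntegrable_rpow' (a := 0) (b := 1 / 2) hβ)
    refine (this.mul_continuousOn (g := fun x => (1 - x)⁻¹) ?_)
    refine ContinuousOn.inv₀ (by fun_prop) fun x hx => ?_
    rw [uIcc_of_le (by norm_num)] at hx
    linarith [hx.2]
  refine h1.trans ((intervalIntegrable_gammaSlope α one_half_pos hw).congr_ae ?_)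
  exact (gammaIntegrand_ae_eq α _).symm

/-- The primitive of `gammaIntegrand α` vanishing at `0`. -/
noncomputable def gammaPrimitive (α w : ℝ) : ℝ :=
  ∫ x in (0 : ℝ)..w, gammaIntegrand α x

theorem hasDerivAt_gammaPrimitive {α : ℝ} (hα : 0 < α) {w : ℝ} (hw : 0 < w) :
    HasDerivAt (gammaPrimitive α) (gammaSlope α w) w := by
  have hc : ∀ x ∈ Ioi (0 : ℝ), ContinuousAt (gammaSlope α) x := fun x hx =>
    (analyticAt_gammaSlope α hx).continuousAt
  have h1 := intervalIntegral.integral_hasDerivAt_right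
    (intervalIntegrable_gammaSlope α one_pos hw)
    (ContinuousOn.stronglyMeasurableAtFilter isOpen_Ioi
      (fun x hx => (hc x hx).continuousWithinAt) w hw) (hc w hw)
  refine (h1.const_add (gammaPrimitive α 1)).congr_of_eventuallyEq ?_
  filter_upwards [isOpen_Ioi.mem_nhds hw] with y hy
  have h2 : ∫ x in (1 : ℝ)..y, gammaSlope α x = ∫ x in (1 : ℝ)..y, gammaIntegrand α x :=
    intervalIntegral.integral_congr_ae_restrict (gammaIntegrand_ae_eq α _).symm
  rw [h2, gammaPrimitive, gammaPrimitive]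
  refine (intervalIntegral.integral_add_adjacent_intervals
    (intervalIntegrable_gammaIntegrand hα zero_le_one) ?_).symm
  exact (intervalIntegrable_gammaIntegrand hα zero_le_one).symm.trans
    (intervalIntegrable_gammaIntegrand hα (mem_Ioi.1 hy).le)

theorem analyticAt_gammaPrimitive {α : ℝ} (hα : 0 < α) {w : ℝ} (hw : 0 < w) :
    AnalyticAt ℝ (gammaPrimitive α) w :=
  analyticAt_of_hasDerivAt ((lt_mem_nhds hw).mono fun _ hy => hasDerivAt_gammaPrimitive hα hy)
    (analyticAt_gammaSlope α hw)

theorem continuousOn_gammaPrimitive {α : ℝ} (hα : 0 < α) :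
    ContinuousOn (gammaPrimitive α) (Ici 0) := by
  intro w hw
  have hw : 0 ≤ w := hw
  have h := intervalIntegral.continuousOn_primitive_interval' (a := 0) (b₁ := 0) (b₂ := w + 1)
    (intervalIntegrable_gammaIntegrand hα (by linarith)) left_mem_uIcc
  rw [uIcc_of_le (by linarith)] at h
  refine (h w ⟨hw, by linarith⟩).mono_of_mem_nhdsWithin ?_
  rw [← Ici_inter_Iic]
  exact inter_mem self_mem_nhdsWithin (mem_nhdsWithin_of_mem_nhds (Iic_mem_nhds (by linarith)))

theorem gammaPrimitive_monotoneOn {α : ℝ} (hα : 0 < α) (hα1 : α < 1) :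
    MonotoneOn (gammaPrimitive α) (Ici 0) := by
  refine monotoneOn_of_deriv_nonneg (convex_Ici 0) (continuousOn_gammaPrimitive hα) ?_ ?_ <;>
    rw [interior_Ici] <;> intro w hw
  · exact (hasDerivAt_gammaPrimitive hα hw).differentiableAt.differentiableWithinAt
  · rw [(hasDerivAt_gammaPrimitive hα hw).deriv]
    exact gammaSlope_nonneg hα hα1 hw

/-! ### The linearising function T and its density -/

/-- The density `exp (∫₀^(u^α) gammaIntegrand)`, extended by `1` to `u < 0`. -/
noncomputable def profileDensity (α u : ℝ) : ℝ :=
  Real.exp (gammaPrimitive α (max u 0 ^ α))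

theorem profileDensity_pos (α u : ℝ) : 0 < profileDensity α u := Real.exp_pos _

theorem profileDensity_of_nonpos {α : ℝ} (hα : 0 < α) {u : ℝ} (hu : u ≤ 0) :
    profileDensity α u = 1 := by
  simp [profileDensity, max_eq_right hu, Real.zero_rpow hα.ne', gammaPrimitive]

theorem profileDensity_one (α : ℝ) :
    profileDensity α 1 = Real.exp (∫ x in (0 : ℝ)..1, gammaIntegrand α x) := by
  simp [profileDensity, gammaPrimitive]

theorem profileDensity_eventuallyEq (α : ℝ) {u : ℝ} (hu : 0 < u) :
    profileDensity α =ᶠ[𝓝 u] fun v => Real.exp (gammaPrimitive α (v ^ α)) := by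
  filter_upwards [isOpen_Ioi.mem_nhds hu] with v hv
  rw [profileDensity, max_eq_left (mem_Ioi.1 hv).le]

theorem continuous_profileDensity {α : ℝ} (hα : 0 < α) : Continuous (profileDensity α) := by
  refine Real.continuous_exp.comp ?_
  refine (continuousOn_gammaPrimitive hα).comp_continuous ?_ fun u => ?_
  · exact (continuous_id.max continuous_const).rpow_const fun _ => Or.inr hα.le
  · exact Real.rpow_nonneg (le_max_right _ _) _

theorem analyticAt_profileDensity {α : ℝ} (hα : 0 < α) {u : ℝ} (hu : 0 < u) :
    AnalyticAt ℝ (profileDensity α) u := by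
  have h1 : AnalyticAt ℝ (fun v : ℝ => gammaPrimitive α (v ^ α)) u :=
    (analyticAt_gammaPrimitive hα (Real.rpow_pos_of_pos hu α)).fun_comp
      (f := fun v : ℝ => v ^ α) (analyticAt_rpow_const hu.ne' α)
  exact h1.rexp.congr (profileDensity_eventuallyEq α hu).symm

theorem hasDerivAt_profileDensity {α : ℝ} (hα : 0 < α) {u : ℝ} (hu : 0 < u) :
    HasDerivAt (profileDensity α)
      (profileDensity α u * (gammaSlope α (u ^ α) * (α * u ^ (α - 1)))) u := by
  have h1 := ((hasDerivAt_gammaPrimitive hα (Real.rpow_pos_of_pos hu α)).comp u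
    (Real.hasDerivAt_rpow_const (p := α) (Or.inl hu.ne'))).exp
  have h2 := h1.congr_of_eventuallyEq (profileDensity_eventuallyEq α hu)
  rwa [Function.comp_apply, ← (profileDensity_eventuallyEq α hu).eq_of_nhds] at h2

theorem profileDensity_monotone {α : ℝ} (hα : 0 < α) (hα1 : α < 1) :
    Monotone (profileDensity α) := fun u v huv => by
  refine Real.exp_le_exp.2 (gammaPrimitive_monotoneOn hα hα1 ?_ ?_ ?_)
  · exact Real.rpow_nonneg (le_max_right _ _) _
  · exact Real.rpow_nonneg (le_max_right _ _) _
  · exact Real.rpow_le_rpow (le_max_right _ _) (max_le_max_right 0 huv) hα.le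

/-- The strictly decreasing function `T` with `T (F x) = exp (-α x)` for the profile `F`. -/
noncomputable def profileTime (α u : ℝ) : ℝ :=
  -∫ v in (1 : ℝ)..u, α * profileDensity α v

theorem profileTime_one (α : ℝ) : profileTime α 1 = 0 := by simp [profileTime]

theorem hasDerivAt_profileTime {α : ℝ} (hα : 0 < α) (u : ℝ) :
    HasDerivAt (profileTime α) (-(α * profileDensity α u)) u :=
  (((continuous_profileDensity hα).const_mul α).integral_hasStrictDerivAt 1 u).hasDerivAt.neg

theorem continuous_profileTime {α : ℝ} (hα : 0 < α) : Continuous (profileTime α) :=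
  continuous_iff_continuousAt.2 fun u => (hasDerivAt_profileTime hα u).continuousAt

theorem strictAnti_profileTime {α : ℝ} (hα : 0 < α) : StrictAnti (profileTime α) :=
  strictAnti_of_deriv_neg fun u => by
    rw [(hasDerivAt_profileTime hα u).deriv]
    exact neg_neg_of_pos (mul_pos hα (profileDensity_pos α u))

theorem analyticAt_profileTime {α : ℝ} (hα : 0 < α) {u : ℝ} (hu : 0 < u) :
    AnalyticAt ℝ (profileTime α) u :=
  analyticAt_of_hasDerivAt (Eventually.of_forall (hasDerivAt_profileTime hα))
    (analyticAt_const.mul (analyticAt_profileDensity hα hu)).neg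

/-- Both sides vanish at 1 and have derivative -α D on u > 0, because (u^α)^{(1-α)/α} u^{α-1} = 1;
the integrand of γ is exactly what makes this work. The point u = 0 follows by continuity. -/
theorem profileTime_eq {α : ℝ} (hα : 0 < α) {u : ℝ} (hu : 0 ≤ u) :
    profileTime α u = (1 - u ^ α) * profileDensity α u := by
  have hpos : EqOn (profileTime α) (fun u => (1 - u ^ α) * profileDensity α u) (Ioi 0) := by
    have hd : ∀ u ∈ Ioi (0 : ℝ), HasDerivAt (fun u => (1 - u ^ α) * profileDensity α u)
        (-(α * profileDensity α u)) u := fun u hu => by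
      have hu : 0 < u := hu
      refine (((Real.hasDerivAt_rpow_const (p := α) (Or.inl hu.ne')).const_sub 1).mul
        (hasDerivAt_profileDensity hα hu)).congr_deriv ?_
      have h1 := one_sub_mul_gammaSlope α (u ^ α)
      have h2 : (u ^ α) ^ ((1 - α) / α) * u ^ (α - 1) = 1 := by
        rw [← Real.rpow_mul hu.le, ← Real.rpow_add hu, mul_div_cancel₀ _ hα.ne']
        simp
      linear_combination profileDensity α u * α * u ^ (α - 1) * h1 - profileDensity α u * α * h2
    refine isOpen_Ioi.eqOn_of_deriv_eq isPreconnected_Ioi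
      (fun u _ => (hasDerivAt_profileTime hα u).differentiableAt.differentiableWithinAt)
      (fun u hu => (hd u hu).differentiableAt.differentiableWithinAt)
      (fun u hu => ?_) (mem_Ioi.2 one_pos) (by simp [profileTime_one])
    rw [(hd u hu).deriv, (hasDerivAt_profileTime hα u).deriv]
  have hcont : Continuous fun u => (1 - u ^ α) * profileDensity α u :=
    (continuous_const.sub (continuous_id.rpow_const fun _ => Or.inr hα.le)).mul
      (continuous_profileDensity hα)
  have := hpos.closure (continuous_profileTime hα) hcont
  rw [closure_Ioi] at this
  exact this hu

theorem profileTime_zero {α : ℝ} (hα : 0 < α) : profileTime α 0 = 1 := by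
  rw [profileTime_eq hα le_rfl, profileDensity_of_nonpos hα le_rfl, Real.zero_rpow hα.ne']
  norm_num

/-- This linear branch puts t = 1 in the interior of the range of T, so the inverse is
differentiable there, that is, at x = 0 for the profile. -/
theorem profileTime_neg {α : ℝ} (hα : 0 < α) {u : ℝ} (hu : u ≤ 0) :
    profileTime α u = 1 - α * u := by
  have h : ∫ v in (0 : ℝ)..u, α * profileDensity α v = α * u := by
    have : ∫ v in (0 : ℝ)..u, α * profileDensity α v = ∫ v in (0 : ℝ)..u, α := by
      refine intervalIntegral.integral_congr fun v hv => ?_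
      rw [uIcc_of_ge hu] at hv
      simp [profileDensity_of_nonpos hα hv.2]
    rw [this]
    simp [mul_comm]
  have h0 := profileTime_zero hα
  have hint : ∀ a b, IntervalIntegrable (fun v => α * profileDensity α v)
      MeasureTheory.volume a b := fun a b =>
    ((continuous_profileDensity hα).const_mul α).intervalIntegrable a b
  rw [profileTime] at h0 ⊢
  rw [← intervalIntegral.integral_add_adjacent_intervals (hint 1 0) (hint 0 u)]
  linarith

theorem Ici_subset_range_profileTime {α : ℝ} (hα : 0 < α) : Ici 0 ⊆ range (profileTime α) :=
  fun t ht => by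
    have ht : 0 ≤ t := ht
    refine mem_range_of_exists_le_of_exists_ge (continuous_profileTime hα)
      ⟨1, by rwa [profileTime_one]⟩ ⟨-t / α, ?_⟩
    rw [profileTime_neg hα (div_nonpos_of_nonpos_of_nonneg (by linarith) hα.le),
      mul_div_cancel₀ _ hα.ne']
    linarith

theorem range_profileTime {α : ℝ} (hα : 0 < α) (hα1 : α < 1) : range (profileTime α) = univ := by
  refine eq_univ_of_forall fun t => ?_
  rcases le_or_gt 0 t with ht | ht
  · exact Ici_subset_range_profileTime hα ht
  -- At u = (1 - t)^{1/α} one has T(u) = t D(u) ≤ t, since t < 0 and D ≥ 1.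
  refine mem_range_of_exists_le_of_exists_ge (continuous_profileTime hα)
    ⟨(1 - t) ^ (1 / α), ?_⟩ ⟨1, by rw [profileTime_one]; exact ht.le⟩
  have h0 : 0 ≤ (1 - t) ^ (1 / α) := Real.rpow_nonneg (by linarith) _
  rw [profileTime_eq hα h0, ← Real.rpow_mul (by linarith), one_div_mul_cancel hα.ne',
    Real.rpow_one]
  have h1 := profileDensity_monotone hα hα1 h0
  rw [profileDensity_of_nonpos hα le_rfl] at h1
  nlinarith

theorem isOpenEmbedding_profileTime {α : ℝ} (hα : 0 < α) :
    Topology.IsOpenEmbedding (profileTime α) := by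
  refine .of_continuous_injective_isOpenMap (continuous_profileTime hα)
    (strictAnti_profileTime hα).injective ?_
  refine isOpenMap_of_hasStrictDerivAt (f' := fun u => -(α * profileDensity α u)) (fun u => ?_)
    fun u => (neg_neg_of_pos (mul_pos hα (profileDensity_pos α u))).ne
  exact hasStrictDerivAt_of_hasDerivAt_of_continuousAt
    (Eventually.of_forall (hasDerivAt_profileTime hα))
    ((continuous_profileDensity hα).const_mul α).neg.continuousAt

/-! ### The inverse of T and existence of the profile -/

/-- The inverse of `profileTime α` on its range. -/
noncomputable def profileInv (α : ℝ) : ℝ → ℝ := Function.invFun (profileTime α)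

theorem profileInv_profileTime {α : ℝ} (hα : 0 < α) (u : ℝ) :
    profileInv α (profileTime α u) = u :=
  Function.leftInverse_invFun (strictAnti_profileTime hα).injective u

theorem profileTime_profileInv {α t : ℝ} (ht : t ∈ range (profileTime α)) :
    profileTime α (profileInv α t) = t :=
  Function.invFun_eq ht

theorem continuousAt_profileInv {α t : ℝ} (hα : 0 < α) (ht : t ∈ range (profileTime α)) :
    ContinuousAt (profileInv α) t := by
  obtain ⟨u, rfl⟩ := ht
  rw [(isOpenEmbedding_profileTime hα).continuousAt_iff.symm]
  have : profileInv α ∘ profileTime α = id := funext (profileInv_profileTime hα)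
  rw [this]
  exact continuousAt_id

theorem hasDerivAt_profileInv {α t : ℝ} (hα : 0 < α) (ht : t ∈ range (profileTime α)) :
    HasDerivAt (profileInv α) (-(α * profileDensity α (profileInv α t)))⁻¹ t :=
  (hasDerivAt_profileTime hα _).of_local_left_inverse (continuousAt_profileInv hα ht)
    (neg_neg_of_pos (mul_pos hα (profileDensity_pos α _))).ne
    (by filter_upwards [(isOpenEmbedding_profileTime hα).isOpen_range.mem_nhds ht] with y hy
        exact profileTime_profileInv hy)

theorem profileInv_strictAntiOn {α : ℝ} (hα : 0 < α) :
    StrictAntiOn (profileInv α) (range (profileTime α)) := by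
  rintro _ ⟨u, rfl⟩ _ ⟨v, rfl⟩ h
  rw [profileInv_profileTime hα, profileInv_profileTime hα]
  exact (strictAnti_profileTime hα).lt_iff_gt.1 h

theorem profileInv_pos {α t : ℝ} (hα : 0 < α) (ht : t ∈ range (profileTime α)) (ht1 : t < 1) :
    0 < profileInv α t := by
  rw [← (strictAnti_profileTime hα).lt_iff_gt, profileTime_profileInv ht, profileTime_zero hα]
  exact ht1

/-- The condition t < 1 places the inverse at u > 0, where T is analytic with nonzero derivative. -/
theorem analyticAt_profileInv {α t : ℝ} (hα : 0 < α) (ht : t ∈ range (profileTime α))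
    (ht1 : t < 1) : AnalyticAt ℝ (profileInv α) t := by
  set e := (isOpenEmbedding_profileTime hα).toOpenPartialHomeomorph (profileTime α) with he
  have hsymm : e.symm t = profileInv α t := by
    obtain ⟨u, rfl⟩ := ht
    rw [profileInv_profileTime hα]
    exact (isOpenEmbedding_profileTime hα).toOpenPartialHomeomorph_left_inv
  have hpos := profileInv_pos hα ht ht1
  have h := e.contDiffAt_symm_deriv (n := (⊤ : WithTop ℕ∞)) (a := t)
    (f₀' := -(α * profileDensity α (e.symm t)))
    (neg_neg_of_pos (mul_pos hα (profileDensity_pos α _))).ne (by simpa [he] using ht)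
    (by simpa [he] using hasDerivAt_profileTime hα _)
    (by
      rw [hsymm]
      exact (analyticAt_profileTime hα hpos).contDiffAt)
  refine h.analyticAt.congr ?_
  filter_upwards [(isOpenEmbedding_profileTime hα).isOpen_range.mem_nhds ht] with y hy
  obtain ⟨u, rfl⟩ := hy
  rw [profileInv_profileTime hα]
  exact (isOpenEmbedding_profileTime hα).toOpenPartialHomeomorph_left_inv

theorem one_sub_rpow_eq {α u : ℝ} (hα : 0 < α) (hu : 0 ≤ u) :
    1 - u ^ α = profileTime α u / profileDensity α u := by
  rw [profileTime_eq hα hu, mul_div_cancel_right₀ _ (profileDensity_pos α u).ne']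

/-- The profile is `x ↦ profileInv α (exp (-α x))`. -/
theorem exists_isProfile {α : ℝ} (hα : 0 < α) : ∃ F, IsProfile α F := by
  refine ⟨fun x => profileInv α (Real.exp (-α * x)), ?_, fun x hx => ?_⟩
  · simp only [mul_zero, Real.exp_zero]
    rw [← profileTime_zero hα, profileInv_profileTime hα]
  · have ht := Ici_subset_range_profileTime hα (Real.exp_pos (-α * x)).le
    have h1 : HasDerivAt (fun x => Real.exp (-α * x)) (Real.exp (-α * x) * (-α * 1)) x :=
      ((hasDerivAt_id' x).const_mul (-α)).exp
    have h0 : 0 ≤ profileInv α (Real.exp (-α * x)) := by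
      rw [← (strictAnti_profileTime hα).le_iff_ge, profileTime_profileInv ht, profileTime_zero hα,
        Real.exp_le_one_iff]
      nlinarith
    have h2 := (hasDerivAt_profileInv hα ht).comp x h1
    refine (h2.congr_deriv ?_).hasDerivWithinAt
    rw [one_sub_rpow_eq hα h0, profileTime_profileInv ht]
    have := profileDensity_pos α (profileInv α (Real.exp (-α * x)))
    field_simp

/-! ### Uniqueness of the profile -/

namespace IsProfile

variable {α : ℝ} {F : ℝ → ℝ}

theorem continuousOn (hF : IsProfile α F) : ContinuousOn F (Ici 0) := fun x hx =>
  (hF.2 x hx).continuousWithinAt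

theorem hasDerivAt (hF : IsProfile α F) {x : ℝ} (hx : 0 < x) : HasDerivAt F (1 - F x ^ α) x :=
  (hF.2 x hx.le).hasDerivAt (Ici_mem_nhds hx)

/-- A barrier argument: wherever F vanishes its derivative is 1, so F cannot cross to negative
values, where the formula for T would fail. -/
theorem nonneg (hα : 0 < α) (hF : IsProfile α F) {x : ℝ} (hx : 0 ≤ x) : 0 ≤ F x := by
  have h := image_le_of_deriv_right_lt_deriv_boundary (f := fun y => -F y)
    (f' := fun y => -(1 - F y ^ α)) (a := 0) (b := x) (B := fun _ => 0) (B' := fun _ => 0)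
    (hF.continuousOn.mono Icc_subset_Ici_self).neg
    (fun y hy => ((hF.2 y hy.1).mono (Ici_subset_Ici.2 hy.1)).neg) (by simp [hF.1])
    (fun y => hasDerivAt_const y 0) (fun y _ hy => ?_) (right_mem_Icc.2 hx)
  · simpa using h
  · have : F y = 0 := neg_eq_zero.1 hy
    simp [this, Real.zero_rpow hα.ne']

/-- The chain rule gives (T ∘ F)' = -α D(F)(1 - F^α) = -α T(F). Uniqueness follows without a
Lipschitz condition, which u^α violates at 0 when α < 1. -/
theorem profileTime_apply (hα : 0 < α) (hF : IsProfile α F) {x : ℝ} (hx : 0 ≤ x) :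
    profileTime α (F x) = Real.exp (-α * x) := by
  set G : ℝ → ℝ := fun y => profileTime α (F y) * Real.exp (α * y)
  have hd : ∀ y, 0 < y → HasDerivAt G 0 y := fun y hy => by
    have h1 : HasDerivAt (fun y => Real.exp (α * y)) (Real.exp (α * y) * (α * 1)) y :=
      ((hasDerivAt_id' y).const_mul α).exp
    refine (((hasDerivAt_profileTime hα (F y)).comp y (hF.hasDerivAt hy)).mul h1).congr_deriv ?_
    rw [Function.comp_apply, profileTime_eq hα (hF.nonneg hα hy.le)]
    ring
  have hcont : ContinuousOn G (Icc 0 x) :=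
    ((continuous_profileTime hα).comp_continuousOn
      (hF.continuousOn.mono Icc_subset_Ici_self)).mul (by fun_prop)
  have hG : G x = G 0 := by
    rcases hx.eq_or_lt with rfl | hx
    · rfl
    obtain ⟨y, hy, h⟩ := exists_hasDerivAt_eq_slope G (fun _ => 0) hx hcont fun y hy => hd y hy.1
    rw [eq_comm, div_eq_zero_iff] at h
    rcases h with h | h <;> linarith
  have h0 : G 0 = 1 := by simp [G, hF.1, profileTime_zero hα]
  rw [h0] at hG
  rw [neg_mul, Real.exp_neg]
  exact eq_inv_of_mul_eq_one_left hG

theorem eq_profileInv (hα : 0 < α) (hF : IsProfile α F) {x : ℝ} (hx : 0 ≤ x) :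
    F x = profileInv α (Real.exp (-α * x)) := by
  rw [← hF.profileTime_apply hα hx, profileInv_profileTime hα]

theorem profilePhi_eq (hα : 0 < α) (hF : IsProfile α F) :
    EqOn (fun t => 1 - profileInv α t) (profilePhi α F) (Ioo 0 1) := fun t ht => by
  have h0 : 0 ≤ -(1 / α) * Real.log t :=
    mul_nonneg_of_nonpos_of_nonpos (neg_nonpos.2 (one_div_pos.2 hα).le)
      (Real.log_nonpos ht.1.le ht.2.le)
  have h1 : -α * (-(1 / α) * Real.log t) = Real.log t := by field_simp
  rw [profilePhi, hF.eq_profileInv hα h0, h1, Real.exp_log ht.1]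

end IsProfile

/-! ### The continuation, its differential equation and its Taylor coefficients -/

/-- The analytic continuation `t ↦ 1 - profileInv α t` of `profilePhi α F`. -/
noncomputable def profileExt (α t : ℝ) : ℝ := 1 - profileInv α t

theorem analyticAt_profileExt {α t : ℝ} (hα : 0 < α) (ht : t ∈ range (profileTime α))
    (ht1 : t < 1) : AnalyticAt ℝ (profileExt α) t :=
  analyticAt_const.sub (analyticAt_profileInv hα ht ht1)

theorem hasDerivAt_profileExt {α t : ℝ} (hα : 0 < α) (ht : t ∈ range (profileTime α)) :
    HasDerivAt (profileExt α) (α * profileDensity α (profileInv α t))⁻¹ t := by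
  refine ((hasDerivAt_profileInv hα ht).const_sub 1).congr_deriv ?_
  rw [inv_neg, neg_neg]

theorem zero_mem_range_profileTime (α : ℝ) : (0 : ℝ) ∈ range (profileTime α) :=
  ⟨1, profileTime_one α⟩

theorem profileInv_zero {α : ℝ} (hα : 0 < α) : profileInv α 0 = 1 := by
  rw [← profileTime_one α, profileInv_profileTime hα]

theorem deriv_profileExt_zero {α : ℝ} (hα : 0 < α) : deriv (profileExt α) 0 = profileGamma α := by
  rw [(hasDerivAt_profileExt hα (zero_mem_range_profileTime α)).deriv, profileInv_zero hα,
    profileDensity_one, profileGamma, Real.exp_neg, mul_inv, one_div]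

/-- The second order equation satisfied by the continuation near `0`. -/
theorem profileExt_ode {α : ℝ} (hα : 0 < α) :
    (fun t => t * deriv (deriv (profileExt α)) t) =ᶠ[𝓝 0] fun t =>
      deriv (fun t => t * deriv (profileExt α) t) t * profileExt α t -
        α * (t * (deriv (profileExt α) t * deriv (profileExt α) t)) := by
  have hopen : IsOpen (range (profileTime α) ∩ Iio 1) :=
    (isOpenEmbedding_profileTime hα).isOpen_range.inter isOpen_Iio
  have hmem : range (profileTime α) ∩ Iio 1 ∈ 𝓝 (0 : ℝ) :=
    hopen.mem_nhds ⟨zero_mem_range_profileTime α, mem_Iio.2 one_pos⟩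
  -- The first-order equation αtφ' = 1 - (1 - φ)^α, now valid also at t ≤ 0.
  have hfirst : ∀ t ∈ range (profileTime α) ∩ Iio 1,
      t * deriv (profileExt α) t = (1 - profileInv α t ^ α) / α := fun t ht => by
    rw [(hasDerivAt_profileExt hα ht.1).deriv, one_sub_rpow_eq hα (profileInv_pos hα ht.1 ht.2).le,
      profileTime_profileInv ht.1]
    field_simp
  filter_upwards [hmem] with t ht
  have hpos := profileInv_pos hα ht.1 ht.2
  have hq : HasDerivAt (deriv (profileExt α)) (deriv (deriv (profileExt α)) t) t :=
    (analyticAt_profileExt hα ht.1 ht.2).deriv.differentiableAt.hasDerivAt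
  have h1 := (hasDerivAt_id' t).fun_mul hq
  have h1' : deriv (fun t => t * deriv (profileExt α) t) t =
      deriv (profileExt α) t + t * deriv (deriv (profileExt α)) t := by
    simpa using h1.deriv
  have hinv : HasDerivAt (profileInv α) (-deriv (profileExt α) t) t := by
    rw [(hasDerivAt_profileExt hα ht.1).deriv, ← inv_neg]
    exact hasDerivAt_profileInv hα ht.1
  have h2 : HasDerivAt (fun t => (1 - profileInv α t ^ α) / α)
      (profileInv α t ^ (α - 1) * deriv (profileExt α) t) t := by
    refine (((hinv.rpow_const (p := α) (Or.inl hpos.ne')).const_sub 1).div_const α).congr_deriv ?_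
    field_simp
  have h3 : deriv (fun t => t * deriv (profileExt α) t) t =
      profileInv α t ^ (α - 1) * deriv (profileExt α) t := by
    refine (h2.congr_of_eventuallyEq ?_).deriv
    exact eventually_of_mem (hopen.mem_nhds ht) hfirst
  have h4 : profileInv α t * profileInv α t ^ (α - 1) = profileInv α t ^ α := by
    rw [← Real.rpow_one_add' hpos.le (by simpa using hα.ne'), add_sub_cancel]
  have h5 := hfirst t ht
  rw [eq_div_iff hα.ne'] at h5
  have h6 : profileExt α t = 1 - profileInv α t := rfl
  rw [h6]
  -- Multiplying (tφ')' = (1 - φ)^{α-1} φ' by 1 - φ produces (1 - φ)^α, which the first-order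
  -- equation replaces by 1 - αtφ'.
  linear_combination -h1' + profileInv α t * h3 + deriv (profileExt α) t * h4
    + deriv (profileExt α) t * h5

theorem taylorCoeff_profileExt_rec {α : ℝ} (hα : 0 < α) (m : ℕ) :
    taylorCoeff (profileExt α) (m + 2) = 1 / (((m : ℝ) + 2) * ((m : ℝ) + 1)) *
      ∑ i ∈ Finset.range (m + 1), taylorCoeff (profileExt α) (i + 1) *
        taylorCoeff (profileExt α) (m + 1 - i) *
        ((1 + α) * ((i : ℝ) + 1) - α * ((m : ℝ) + 2)) * ((i : ℝ) + 1) := by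
  set a := taylorCoeff (profileExt α)
  have ha : AnalyticAt ℝ (profileExt α) 0 :=
    analyticAt_profileExt hα (zero_mem_range_profileTime α) one_pos
  have hq := ha.deriv
  have htq : AnalyticAt ℝ (fun t => t * deriv (profileExt α) t) 0 := analyticAt_id.mul hq
  have hqq : AnalyticAt ℝ (fun t => deriv (profileExt α) t * deriv (profileExt α) t) 0 := hq.mul hq
  have ha0 : a 0 = 0 := by simp [a, taylorCoeff, profileExt, profileInv_zero hα]
  have hc1 : ∀ n, taylorCoeff (deriv (profileExt α)) n = (n + 1) * a (n + 1) :=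
    taylorCoeff_deriv _
  have hc2 : ∀ n, taylorCoeff (deriv fun t => t * deriv (profileExt α) t) n =
      (n + 1) * ((n + 1) * a (n + 1)) := fun n => by
    rw [taylorCoeff_deriv, taylorCoeff_id_mul hq, if_neg n.succ_ne_zero, Nat.add_sub_cancel, hc1]
  have hl : taylorCoeff (fun t => t * deriv (deriv (profileExt α)) t) (m + 1) =
      (m + 1) * ((m + 2) * a (m + 2)) := by
    rw [taylorCoeff_id_mul hq.deriv, if_neg m.succ_ne_zero, Nat.add_sub_cancel, taylorCoeff_deriv,
      hc1]
    push_cast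
    ring
  have hr1 : taylorCoeff (fun t => deriv (fun t => t * deriv (profileExt α) t) t * profileExt α t)
      (m + 1) = ∑ i ∈ Finset.range (m + 1),
        (i + 1) * ((i + 1) * a (i + 1)) * a (m + 1 - i) := by
    -- The top term carries the factor `a 0 = 0`, so `a (m + 2)` is absent from the right side and
    -- the recurrence is explicit.
    rw [taylorCoeff_mul htq.deriv ha, Finset.sum_range_succ, Nat.sub_self]
    simp only [hc2]
    change _ + _ * a 0 = _
    rw [ha0, mul_zero, add_zero]
  have hr2 : taylorCoeff (fun t => α * (t * (deriv (profileExt α) t * deriv (profileExt α) t)))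
      (m + 1) = α * ∑ i ∈ Finset.range (m + 1),
        (i + 1) * a (i + 1) * (((m - i : ℕ) + 1) * a (m - i + 1)) := by
    rw [taylorCoeff_const_mul, taylorCoeff_id_mul hqq, if_neg m.succ_ne_zero, Nat.add_sub_cancel,
      taylorCoeff_mul hq hq]
    simp only [hc1]
  have h := taylorCoeff_congr (profileExt_ode hα) (m + 1)
  rw [taylorCoeff_sub (f := fun t => deriv (fun t => t * deriv (profileExt α) t) t *
    profileExt α t) (g := fun t => α * (t * (deriv (profileExt α) t * deriv (profileExt α) t)))
    (htq.deriv.mul ha) (analyticAt_const.mul (analyticAt_id.mul hqq)), hl, hr1, hr2,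
    Finset.mul_sum, ← Finset.sum_sub_distrib] at h
  rw [one_div_mul_eq_div, eq_div_iff (by positivity)]
  trans (m + 1) * ((m + 2) * a (m + 2))
  · ring
  rw [h]
  refine Finset.sum_congr rfl fun i hi => ?_
  have hi : i ≤ m := Nat.lt_succ_iff.1 (Finset.mem_range.1 hi)
  rw [Nat.sub_add_comm hi, Nat.cast_sub hi]
  ring

/-- The recurrence is homogeneous: the indices in each product add up to k, so powers of γ factor
out and the first coefficient determines the rest. -/
theorem taylorCoeff_profileExt {α : ℝ} (hα : 0 < α) (k : ℕ) :
    taylorCoeff (profileExt α) k = profileSigma α k * profileGamma α ^ k := by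
  induction k using Nat.strong_induction_on with
  | _ k ih =>
    match k with
    | 0 => simp [taylorCoeff, profileExt, profileInv_zero hα, profileSigma]
    | 1 => simp [taylorCoeff, deriv_profileExt_zero hα, profileSigma]
    | m + 2 =>
      rw [taylorCoeff_profileExt_rec hα, profileSigma,
        Fin.sum_univ_eq_sum_range (fun i => profileSigma α (i + 1) * profileSigma α (m + 1 - i) *
          ((1 + α) * ((i : ℝ) + 1) - α * ((m : ℝ) + 2)) * ((i : ℝ) + 1)), mul_assoc,
        Finset.sum_mul]
      congr 1
      refine Finset.sum_congr rfl fun i hi => ?_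
      have hi := Finset.mem_range.1 hi
      rw [ih (i + 1) (by omega), ih (m + 1 - i) (by omega)]
      have : profileGamma α ^ (m + 2) = profileGamma α ^ (i + 1) * profileGamma α ^ (m + 1 - i) := by
        rw [← pow_add]
        congr 1
        omega
      rw [this]
      ring

/-! ### Positivity of the σ_k -/

/-- Individual summands may be negative, but those for ν and μ = k - ν add up to σ_ν σ_μ [(1 - α)(ν²
+ μ²) + α(ν - μ)²]. -/
theorem profileSigma_pos {α : ℝ} (hα : 0 < α) (hα1 : α < 1) {k : ℕ} (hk : 1 ≤ k) :
    0 < profileSigma α k := by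
  induction k using Nat.strong_induction_on with
  | _ k ih =>
    match k with
    | 0 => omega
    | 1 => simp [profileSigma]
    | m + 2 =>
      rw [profileSigma]
      refine mul_pos (by positivity) ?_
      set f : ℕ → ℝ := fun i => profileSigma α (i + 1) * profileSigma α (m + 1 - i) *
          ((1 + α) * ((i : ℝ) + 1) - α * ((m : ℝ) + 2)) * ((i : ℝ) + 1) with hf
      rw [Fin.sum_univ_eq_sum_range f]
      have hsym : 0 < ∑ i ∈ Finset.range (m + 1), (f i + f (m - i)) := by
        refine Finset.sum_pos (fun i hi => ?_) (by simp)
        have hi : i ≤ m := Nat.lt_succ_iff.1 (Finset.mem_range.1 hi)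
        obtain ⟨j, rfl⟩ := Nat.exists_eq_add_of_le hi
        have e1 : i + j + 1 - i = j + 1 := by omega
        have e2 : i + j - i = j := by omega
        have e3 : i + j + 1 - j = i + 1 := by omega
        have hi' := ih (i + 1) (by omega) (by omega)
        have hj' := ih (j + 1) (by omega) (by omega)
        have key : f i + f (i + j - i) = profileSigma α (i + 1) * profileSigma α (j + 1) *
            ((1 - α) * (((i : ℝ) + 1) ^ 2 + ((j : ℝ) + 1) ^ 2) + α * ((i : ℝ) - j) ^ 2) := by
          simp only [hf, e1, e2, e3]
          push_cast
          ring
        rw [key]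
        have : 0 < 1 - α := sub_pos.2 hα1
        positivity
      rw [Finset.sum_add_distrib] at hsym
      have hrefl : ∑ i ∈ Finset.range (m + 1), f (m - i) = ∑ i ∈ Finset.range (m + 1), f i := by
        simpa using Finset.sum_range_reflect f (m + 1)
      rw [hrefl] at hsym
      linarith

/-! ### Comparison of continuations, global convergence and convexity -/

theorem profileExt_isAnalyticContinuation {α : ℝ} {F : ℝ → ℝ} (hα : 0 < α) (hF : IsProfile α F)
    {U : Set ℝ} (hU : U ⊆ Iio 1) (h01 : Ioo 0 1 ⊆ U) (hr : U ⊆ range (profileTime α)) :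
    IsAnalyticContinuation (profilePhi α F) U (profileExt α) :=
  ⟨h01, fun _ ht => analyticAt_profileExt hα (hr ht) (hU ht), hF.profilePhi_eq hα⟩

theorem IsAnalyticContinuation.eqOn {f g h : ℝ → ℝ} {U V W : Set ℝ}
    (hg : IsAnalyticContinuation f U g) (hh : IsAnalyticContinuation f V h) (hWU : W ⊆ U)
    (hWV : W ⊆ V) (h01 : Ioo 0 1 ⊆ W) (hW : IsPreconnected W) : EqOn g h W :=
  (hg.2.1.mono hWU).eqOn_of_eqOn_open (hh.2.1.mono hWV) hW isOpen_Ioo h01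
    (nonempty_Ioo.2 one_pos) fun _ ht => (hg.2.2 ht).trans (hh.2.2 ht).symm

theorem exists_Ioo_subset_range_profileTime {α : ℝ} (hα : 0 < α) :
    ∃ ε > 0, Ioo (-ε) 1 ⊆ range (profileTime α) := by
  obtain ⟨ε, hε, h⟩ := Metric.isOpen_iff.1 (isOpenEmbedding_profileTime hα).isOpen_range 0
    (zero_mem_range_profileTime α)
  refine ⟨ε, hε, fun t ht => ?_⟩
  rcases le_or_gt 0 t with h0 | h0
  · exact Ici_subset_range_profileTime hα h0
  · refine h ?_
    rw [mem_ball_zero_iff, Real.norm_eq_abs, abs_of_neg h0]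
    linarith [ht.1]

theorem hasSum_shift_iff {α : ℝ} (hα : 0 < α) {t s : ℝ} :
    HasSum (fun k : ℕ => profileSigma α (k + 1) * (profileGamma α * t) ^ (k + 1)) s ↔
      HasSum (fun k => taylorCoeff (profileExt α) k * t ^ k) s := by
  rw [← hasSum_nat_add_iff' (f := fun k => taylorCoeff (profileExt α) k * t ^ k) 1]
  simp only [Finset.sum_range_one, taylorCoeff_profileExt hα, profileSigma, zero_mul, sub_zero,
    mul_pow, mul_assoc]

theorem summable_taylorCoeff_profileExt {α : ℝ} (hα : 0 < α) (hα1 : α < 1) {t : ℝ}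
    (ht : t ∈ Ioo (-1) 1) : Summable fun k => taylorCoeff (profileExt α) k * t ^ k := by
  refine summable_taylorCoeff_of_nonneg (fun t ht => ?_) (fun n => ?_) ht
  · exact analyticAt_profileExt hα (Ici_subset_range_profileTime hα ht.1) ht.2
  · rw [taylorCoeff_profileExt hα]
    have hγ : 0 < profileGamma α := mul_pos (one_div_pos.2 hα) (Real.exp_pos _)
    rcases n.eq_zero_or_pos with rfl | hn
    · simp [profileSigma]
    · exact (mul_pos (profileSigma_pos hα hα1 hn) (pow_pos hγ n)).le

/-- The sum and the continuation are both analytic on (-1, 1) and agree near 0, so the identity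
theorem applies. -/
theorem hasSum_taylorCoeff_profileExt {α : ℝ} (hα : 0 < α) (hα1 : α < 1) {t : ℝ}
    (ht : t ∈ Ioo (-1) 1) :
    HasSum (fun k => taylorCoeff (profileExt α) k * t ^ k) (profileExt α t) := by
  have hs : ∀ t ∈ Ioo (-1 : ℝ) 1, _ := fun _ ht => summable_taylorCoeff_profileExt hα hα1 ht
  have ha : AnalyticOnNhd ℝ (profileExt α) (Ioo (-1) 1) := fun _ ht =>
    analyticAt_profileExt hα (by rw [range_profileTime hα hα1]; trivial) ht.2
  obtain ⟨r, hr, h⟩ := (ha 0 ⟨by norm_num, one_pos⟩).eventually_hasSum_taylorCoeff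
  have heq := ha.eqOn_of_preconnected_of_eventuallyEq (analyticOnNhd_tsum hs) isPreconnected_Ioo
    (z₀ := 0) ⟨by norm_num, one_pos⟩ (by
      filter_upwards [Metric.ball_mem_nhds 0 hr] with t ht
      exact (h t (by simpa using ht)).tsum_eq.symm)
  rw [heq ht]
  exact (hs t ht).hasSum

theorem strictMonoOn_profileExt {α : ℝ} (hα : 0 < α) :
    StrictMonoOn (profileExt α) (range (profileTime α)) := fun _ hs _ ht hst =>
  sub_lt_sub_left (profileInv_strictAntiOn hα hs ht hst) 1

/-- The derivative 1/(α D(T⁻¹(t))) is increasing, because T⁻¹ decreases and D increases. -/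
theorem convexOn_profileExt {α : ℝ} (hα : 0 < α) (hα1 : α < 1) :
    ConvexOn ℝ univ (profileExt α) := by
  have hr : ∀ t, t ∈ range (profileTime α) := fun t => by
    rw [range_profileTime hα hα1]; trivial
  refine Monotone.convexOn_univ_of_deriv
    (fun t => (hasDerivAt_profileExt hα (hr t)).differentiableAt) fun s t hst => ?_
  rw [(hasDerivAt_profileExt hα (hr s)).deriv, (hasDerivAt_profileExt hα (hr t)).deriv]
  refine inv_anti₀ (mul_pos hα (profileDensity_pos _ _)) (mul_le_mul_of_nonneg_left ?_ hα.le)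
  exact profileDensity_monotone hα hα1 ((profileInv_strictAntiOn hα).antitoneOn (hr s) (hr t) hst)

theorem theorem4p5 (α : ℝ) (hα : 0 < α) :
    -- the defining problem is uniquely solvable and the integral in `γ_α` converges
    (∃ F, IsProfile α F) ∧
    (∀ F₁ F₂, IsProfile α F₁ → IsProfile α F₂ → EqOn F₁ F₂ (Ici 0)) ∧
    IntervalIntegrable (gammaIntegrand α) MeasureTheory.volume 0 1 ∧
    ∀ F, IsProfile α F →
      -- (i) analytic continuation to `(-ε, 1)`
      (∃ ε > 0, ∃ g, IsAnalyticContinuation (profilePhi α F) (Ioo (-ε) 1) g) ∧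
      -- (ii) Taylor series at `0` of the continuation
      (∀ ε > 0, ∀ g, IsAnalyticContinuation (profilePhi α F) (Ioo (-ε) 1) g →
        ∃ r > 0, ∀ t, |t| < r →
          HasSum (fun k : ℕ => profileSigma α (k + 1) * (profileGamma α * t) ^ (k + 1)) (g t)) ∧
      -- (iii) positivity of the coefficients and convergence on `(-1, 1)`
      (α < 1 →
        (∀ k, 1 ≤ k → 0 < profileSigma α k) ∧
        (∀ t ∈ Ioo (-1 : ℝ) 1,
          Summable (fun k : ℕ => profileSigma α (k + 1) * (profileGamma α * t) ^ (k + 1))) ∧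
        (∀ ε > 0, ∀ g, IsAnalyticContinuation (profilePhi α F) (Ioo (-ε) 1) g →
          ∀ t ∈ Ioo (-1 : ℝ) 1, -ε < t →
            HasSum (fun k : ℕ => profileSigma α (k + 1) * (profileGamma α * t) ^ (k + 1))
              (g t))) ∧
      -- (iv) continuation to `(-∞, 1)`, monotonicity and convexity
      (α < 1 →
        (∃ g, IsAnalyticContinuation (profilePhi α F) (Iio 1) g) ∧
        (∀ g, IsAnalyticContinuation (profilePhi α F) (Iio 1) g →
          StrictMonoOn g (Iio 1) ∧ ConvexOn ℝ (Iio 1) g)) := by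
  refine ⟨exists_isProfile hα, fun F₁ F₂ h₁ h₂ x hx => ?_,
    intervalIntegrable_gammaIntegrand hα zero_le_one, fun F hF => ?_⟩
  · rw [h₁.eq_profileInv hα hx, h₂.eq_profileInv hα hx]
  obtain ⟨δ, hδ, hδr⟩ := exists_Ioo_subset_range_profileTime hα
  have hext : IsAnalyticContinuation (profilePhi α F) (Ioo (-δ) 1) (profileExt α) :=
    profileExt_isAnalyticContinuation hα hF Ioo_subset_Iio_self
      (Ioo_subset_Ioo_left (neg_nonpos.2 hδ.le)) hδr
  have hextU : α < 1 → IsAnalyticContinuation (profilePhi α F) (Iio 1) (profileExt α) := fun hα1 =>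
    profileExt_isAnalyticContinuation hα hF subset_rfl Ioo_subset_Iio_self
      (by rw [range_profileTime hα hα1]; exact subset_univ _)
  refine ⟨⟨δ, hδ, _, hext⟩, fun ε hε g hg => ?_, fun hα1 => ⟨fun k hk => profileSigma_pos hα hα1 hk,
    fun t ht => ?_, fun ε hε g hg t ht hεt => ?_⟩, fun hα1 => ⟨⟨_, hextU hα1⟩, fun g hg => ?_⟩⟩
  · obtain ⟨r, hr, h⟩ := (hext.2.1 0 ⟨neg_lt_zero.2 hδ, one_pos⟩).eventually_hasSum_taylorCoeff
    -- An arbitrary continuation is only comparable with the constructed one on the smaller of the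
    -- two intervals.
    have heq := hg.eqOn hext (W := Ioo (-min ε δ) 1)
      (Ioo_subset_Ioo_left (neg_le_neg (min_le_left _ _)))
      (Ioo_subset_Ioo_left (neg_le_neg (min_le_right _ _)))
      (Ioo_subset_Ioo_left (neg_nonpos.2 (lt_min hε hδ).le)) isPreconnected_Ioo
    refine ⟨min r (min (min ε δ) 1), lt_min hr (lt_min (lt_min hε hδ) one_pos), fun t ht => ?_⟩
    obtain ⟨ht1, ht2⟩ := lt_min_iff.1 ht
    obtain ⟨ht2, ht3⟩ := lt_min_iff.1 ht2
    rw [heq ⟨(abs_lt.1 ht2).1, (abs_lt.1 ht3).2⟩, hasSum_shift_iff hα]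
    exact h t ht1
  · exact ((hasSum_shift_iff hα).2 (hasSum_taylorCoeff_profileExt hα hα1 ht)).summable
  · rw [hg.eqOn (hextU hα1) subset_rfl Ioo_subset_Iio_self hg.1 isPreconnected_Ioo ⟨hεt, ht.2⟩,
      hasSum_shift_iff hα]
    exact hasSum_taylorCoeff_profileExt hα hα1 ht
  · have heq := hg.eqOn (hextU hα1) subset_rfl subset_rfl hg.1 isPreconnected_Iio
    have hsub : Iio 1 ⊆ range (profileTime α) := by
      rw [range_profileTime hα hα1]; exact subset_univ _
    refine ⟨((strictMonoOn_profileExt hα).mono hsub).congr heq.symm, ?_⟩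
    exact ((convexOn_profileExt hα hα1).subset (subset_univ _) (convex_Iio 1)).congr heq.symm
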